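/- Let $\mathbb{R}_+=[0,\infty)$ and let $C_{ub}(\mathbb{R}_+)$ be the Banach algebra of all real-valued bounded uniformly continuous functions on $\mathbb{R}_+$ with the supremum norm. For $s\ge 0$ put $(T_sf)(x)=f(x+s)$. Let $\mathcal{M}\subset C_{ub}(\mathbb{R}_+)^*$ be the set of translation-invariant means, i.e. of the functionals $\varphi\in C_{ub}(\mathbb{R}_+)^*$ such that $\varphi(f)\ge 0$ whenever $f\ge 0$, $\varphi(1)=1$, and $\varphi(T_sf)=\varphi(f)$ for all $f\in C_{ub}(\mathbb{R}_+)$ and $s\ge 0$. Let $\Omega$ be the maximal ideal space of $C_{ub}(\mathbb{R}_+)$, that is, the set of nonzero multiplicative continuous linear functionals $\omega:C_{ub}(\mathbb{R}_+)\to\mathbb{R}$ with the weak* topology. It is a compactification of $\mathbb{R}_+$, where $x\in\mathbb{R}_+$ is identified with the evaluation $f\mapsto f(x)$, and every $f\in C_{ub}(\mathbb{R}_+)$ extends to $\overline{f}\in C(\Omega)$ by $\overline{f}(\omega)=\omega(f)$. Let $\Omega^*=\Omega\setminus\mathbb{R}_+$ be its growth and, for $s\ge 0$, let $\tau^s:\Omega\to\Omega$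 be given by $\tau^s\omega=\omega\circ T_s$, so that $\overline{f}(\tau^s\omega)=\overline{T_sf}(\omega)$. For $\omega\in\Omega^*$ and an ultrafilter $\mathcal{U}$ on $\mathbb{R}_+$ that contains no bounded subset of $\mathbb{R}_+$, define $$\varphi_\omega^{\mathcal{U}}(f)=\mathcal{U}\text{-}\lim_x\ \frac1x\int_0^x\overline{f}(\tau^t\omega)\,dt,\qquad f\in C_{ub}(\mathbb{R}_+),$$ and let $\mathcal{Q}$ be the set of all these functionals $\varphi_\omega^{\mathcal{U}}$. **Theorem 2.2.** $\mathcal{M}=\overline{co}(\mathcal{Q})$, the weak* closed convex hull of $\mathcal{Q}$ in $C_{ub}(\mathbb{R}_+)^*$. -/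

import Mathlib

open scoped NNReal BoundedContinuousFunction

noncomputable section

namespace InvMeans

/-- The Banach algebra `C_ub(ℝ₊)` of bounded uniformly continuous real functions on `ℝ₊ = [0, ∞)`,
with the supremum norm inherited from the bounded continuous functions. -/
def Cub : Subalgebra ℝ (ℝ≥0 →ᵇ ℝ) where
  carrier := {f | UniformContinuous f}
  mul_mem' := by
    intro f g hf hg
    refine Metric.uniformContinuous_iff.2 fun ε hε => ?_
    have hM : 0 < ‖f‖ + ‖g‖ + 1 := by positivity
    obtain ⟨δ₁, hδ₁, h₁⟩ := Metric.uniformContinuous_iff.1 hf _ (div_pos hε hM)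
    obtain ⟨δ₂, hδ₂, h₂⟩ := Metric.uniformContinuous_iff.1 hg _ (div_pos hε hM)
    refine ⟨min δ₁ δ₂, lt_min hδ₁ hδ₂, fun {x y} hxy => ?_⟩
    have hf' := (h₁ (hxy.trans_le (min_le_left _ _))).le
    have hg' := (h₂ (hxy.trans_le (min_le_right _ _))).le
    rw [Real.dist_eq] at hf' hg' ⊢
    have e : (f * g) x - (f * g) y = f x * (g x - g y) + (f x - f y) * g y := by
      simp only [BoundedContinuousFunction.mul_apply]
      ring
    have hd : 0 < ε / (‖f‖ + ‖g‖ + 1) := div_pos hε hM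
    calc |(f * g) x - (f * g) y| ≤ |f x| * |g x - g y| + |f x - f y| * |g y| := by
          rw [e, ← abs_mul, ← abs_mul]
          exact abs_add_le _ _
      _ ≤ ‖f‖ * (ε / (‖f‖ + ‖g‖ + 1)) + ε / (‖f‖ + ‖g‖ + 1) * ‖g‖ := by
          gcongr
          · exact f.norm_coe_le_norm x
          · exact g.norm_coe_le_norm y
      _ < (‖f‖ + ‖g‖ + 1) * (ε / (‖f‖ + ‖g‖ + 1)) := by linarith
      _ = ε := mul_div_cancel₀ ε hM.ne'
  add_mem' := fun hf hg => UniformContinuous.add hf hg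
  algebraMap_mem' := fun _ => uniformContinuous_const

instance : CompleteSpace Cub := by
  have h : IsClosed (Cub : Set (ℝ≥0 →ᵇ ℝ)) := isClosed_of_closure_subset fun f hf => by
    obtain ⟨u, hu, hlim⟩ := mem_closure_iff_seq_limit.1 hf
    exact (BoundedContinuousFunction.tendsto_iff_tendstoUniformly.1 hlim).uniformContinuous
      (Filter.Frequently.of_forall hu)
  exact h.completeSpace_coe

instance : NormOneClass Cub := ⟨norm_one (α := ℝ≥0 →ᵇ ℝ)⟩

theorem uniformContinuous_coe (f : Cub) : UniformContinuous fun x => f.1 x := f.2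

theorem uniformContinuous_translate (f : Cub) (s : ℝ≥0) :
    UniformContinuous fun x => f.1 (x + s) := by
  have h : UniformContinuous fun x : ℝ≥0 => x + s :=
    Metric.uniformContinuous_iff.2 fun ε hε => ⟨ε, hε, fun {x y} hxy => by
      simpa [NNReal.dist_eq] using hxy⟩
  exact (uniformContinuous_coe f).comp h

/-- The function `x ↦ f (x + s)` as an element of `C_ub(ℝ₊)`. -/
def translateFun (s : ℝ≥0) (f : Cub) : Cub :=
  ⟨f.1.compContinuous ⟨fun x => x + s, by fun_prop⟩, uniformContinuous_translate f s⟩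

/-- The translation `f ↦ f (· + s)` on `C_ub(ℝ₊)` as a linear map. -/
def translateLinear (s : ℝ≥0) : Cub →ₗ[ℝ] Cub where
  toFun := translateFun s
  map_add' _ _ := rfl
  map_smul' _ _ := rfl

theorem norm_translateLinear_le (s : ℝ≥0) (f : Cub) : ‖translateLinear s f‖ ≤ 1 * ‖f‖ := by
  rw [one_mul]
  exact (BoundedContinuousFunction.norm_le (f := (translateFun s f).1) (norm_nonneg f)).2
    fun x => f.1.norm_coe_le_norm (x + s)

/-- The translation `(T_s f)(x) = f (x + s)` on `C_ub(ℝ₊)`, for `s ≥ 0`. -/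
def translate (s : ℝ≥0) : Cub →L[ℝ] Cub :=
  ⟨translateLinear s, AddMonoidHomClass.continuous_of_bound (translateLinear s) 1
    (norm_translateLinear_le s)⟩

@[simp] theorem translate_apply (s : ℝ≥0) (f : Cub) (x : ℝ≥0) :
    (translate s f).1 x = f.1 (x + s) := rfl

/-- The set `𝓜` of translation-invariant means on `C_ub(ℝ₊)`, in the dual space with its weak*
topology. -/
def invariantMeans : Set (WeakDual ℝ Cub) :=
  {φ | (∀ f : Cub, (∀ x, 0 ≤ f.1 x) → 0 ≤ φ f) ∧ φ 1 = 1 ∧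
    ∀ (s : ℝ≥0) (f : Cub), φ (translate s f) = φ f}

/-- The compactification `Ω` of `ℝ₊`: the maximal ideal space of `C_ub(ℝ₊)`. -/
abbrev Omega : Type := WeakDual.characterSpace ℝ Cub

/-- The continuous extension `f̄ ∈ C(Ω)` of `f ∈ C_ub(ℝ₊)`, that is, its Gelfand transform
`f̄ ω = ω f`. -/
def extend (f : Cub) : C(Omega, ℝ) := WeakDual.gelfandTransform ℝ Cub f

theorem extend_apply (f : Cub) (ω : Omega) : extend f ω = ω f := rfl

/-- The canonical embedding of `ℝ₊` in `Ω`: a point goes to the evaluation at that point. -/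
def point (x : ℝ≥0) : Omega :=
  ⟨StrongDual.toWeakDual (LinearMap.mkContinuous
      { toFun := fun f : Cub => f.1 x
        map_add' := fun _ _ => rfl
        map_smul' := fun _ _ => rfl }
      1 (fun f => by rw [one_mul]; exact f.1.norm_coe_le_norm x)),
    fun h => one_ne_zero (α := ℝ) (DFunLike.congr_fun h (1 : Cub)),
    fun _ _ => rfl⟩

theorem extend_point (f : Cub) (x : ℝ≥0) : extend f (point x) = f.1 x := rfl

/-- The growth `Ω* = Ω \ ℝ₊`. -/
def growth : Set Omega := (Set.range point)ᶜ

/-- The semiflow `τ^s` on `Ω`, the restriction to `Ω` of the adjoint of `T_s`. -/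
def flow (s : ℝ≥0) (ω : Omega) : Omega :=
  ⟨StrongDual.toWeakDual ((WeakDual.CharacterSpace.toCLM ω).comp (translate s)),
    fun h => one_ne_zero (α := ℝ) ((map_one ω).symm.trans (DFunLike.congr_fun h (1 : Cub))),
    fun f g => map_mul ω (translate s f) (translate s g)⟩

theorem extend_flow (f : Cub) (s : ℝ≥0) (ω : Omega) :
    extend f (flow s ω) = extend (translate s f) ω := rfl

theorem flow_point (s x : ℝ≥0) : flow s (point x) = point (x + s) := rfl

/-- The average `(1/x) ∫₀ˣ f̄(τ^t ω) dt` of `f` along the orbit of `ω`. -/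
def orbitAverage (ω : Omega) (f : Cub) (x : ℝ≥0) : ℝ :=
  (1 / (x : ℝ)) * ∫ t in (0 : ℝ)..x, extend f (flow t.toNNReal ω)

theorem abs_extend_le (f : Cub) (ω : Omega) : |extend f ω| ≤ ‖f‖ :=
  AlgHom.norm_apply_le_self ω f

theorem continuous_translate (f : Cub) : Continuous fun s : ℝ≥0 => translate s f := by
  rw [Metric.continuous_iff]
  intro s ε hε
  obtain ⟨δ, hδ, h⟩ := Metric.uniformContinuous_iff.1 (show UniformContinuous f.1 from f.2)
    (ε / 2) (half_pos hε)
  refine ⟨δ, hδ, fun t ht => lt_of_le_of_lt ?_ (half_lt_self hε)⟩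
  refine (BoundedContinuousFunction.dist_le (half_pos hε).le).2 fun x => (h ?_).le
  simpa [NNReal.dist_eq] using ht

theorem continuous_orbit (ω : Omega) (f : Cub) :
    Continuous fun t : ℝ => extend f (flow t.toNNReal ω) :=
  (map_continuous ω).comp ((continuous_translate f).comp continuous_real_toNNReal)

theorem orbitAverage_add (ω : Omega) (f g : Cub) (x : ℝ≥0) :
    orbitAverage ω (f + g) x = orbitAverage ω f x + orbitAverage ω g x := by
  have h : ∀ t : ℝ, extend (f + g) (flow t.toNNReal ω) =
      extend f (flow t.toNNReal ω) + extend g (flow t.toNNReal ω) :=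
    fun t => map_add (flow t.toNNReal ω) f g
  simp only [orbitAverage, h]
  rw [intervalIntegral.integral_add ((continuous_orbit ω f).intervalIntegrable _ _)
    ((continuous_orbit ω g).intervalIntegrable _ _), mul_add]

theorem orbitAverage_smul (ω : Omega) (c : ℝ) (f : Cub) (x : ℝ≥0) :
    orbitAverage ω (c • f) x = c * orbitAverage ω f x := by
  have h : ∀ t : ℝ, extend (c • f) (flow t.toNNReal ω) = c * extend f (flow t.toNNReal ω) :=
    fun t => map_smul (flow t.toNNReal ω) c f
  simp only [orbitAverage, h]
  rw [intervalIntegral.integral_const_mul]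
  ring

theorem abs_orbitAverage_le (ω : Omega) (f : Cub) (x : ℝ≥0) : |orbitAverage ω f x| ≤ ‖f‖ := by
  have h := intervalIntegral.norm_integral_le_of_norm_le_const (a := (0 : ℝ)) (b := x)
    (f := fun t => extend f (flow t.toNNReal ω)) (C := ‖f‖)
    (fun t _ => abs_extend_le f (flow t.toNNReal ω))
  rw [sub_zero, abs_of_nonneg x.coe_nonneg, Real.norm_eq_abs] at h
  rw [orbitAverage, abs_mul, abs_of_nonneg (by positivity)]
  rcases eq_or_ne x 0 with rfl | hx
  · simp only [NNReal.coe_zero, intervalIntegral.integral_same, abs_zero, mul_zero]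
    exact norm_nonneg f
  · have hx' : (0 : ℝ) < x := by positivity
    rw [one_div, inv_mul_le_iff₀ hx', mul_comm]
    exact h

/-- The averages stay in a compact interval, so they converge along every ultrafilter. -/
theorem tendsto_orbitAverage (ω : Omega) (U : Ultrafilter ℝ≥0) (f : Cub) :
    Filter.Tendsto (orbitAverage ω f) U (nhds (Filter.limUnder (U : Filter ℝ≥0) (orbitAverage ω f))) := by
  obtain ⟨y, -, hy⟩ := (isCompact_Icc (a := -‖f‖) (b := ‖f‖)).ultrafilter_le_nhds
    (U.map (orbitAverage ω f)) (by
      rw [Filter.le_principal_iff]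
      exact Filter.Eventually.of_forall (f := (U : Filter ℝ≥0))
        fun x => abs_le.1 (abs_orbitAverage_le ω f x))
  exact tendsto_nhds_limUnder ⟨y, hy⟩

/-- The functional `φ_ω^𝓤(f) = 𝓤-lim_x (1/x) ∫₀ˣ f̄(τ^t ω) dt` on `C_ub(ℝ₊)`. -/
def orbitMean (ω : Omega) (U : Ultrafilter ℝ≥0) : WeakDual ℝ Cub :=
  StrongDual.toWeakDual (LinearMap.mkContinuous
    { toFun := fun f => Filter.limUnder (U : Filter ℝ≥0) (orbitAverage ω f)
      map_add' := fun f g => by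
        refine Filter.Tendsto.limUnder_eq ?_
        simpa only [← orbitAverage_add] using
          (tendsto_orbitAverage ω U f).add (tendsto_orbitAverage ω U g)
      map_smul' := fun c f => by
        refine Filter.Tendsto.limUnder_eq ?_
        simpa only [← orbitAverage_smul, RingHom.id_apply, smul_eq_mul] using
          (tendsto_orbitAverage ω U f).const_mul c }
    1 (fun f => by
      rw [one_mul]
      exact le_of_tendsto (tendsto_orbitAverage ω U f).norm
        (Filter.Eventually.of_forall fun x => abs_orbitAverage_le ω f x)))

theorem orbitMean_apply (ω : Omega) (U : Ultrafilter ℝ≥0) (f : Cub) :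
    orbitMean ω U f = Filter.limUnder (U : Filter ℝ≥0) (orbitAverage ω f) := rfl

/-- The set `𝓠` of the functionals `φ_ω^𝓤` with `ω ∈ Ω*` and `𝓤` an ultrafilter on `ℝ₊` that
contains no bounded set. -/
def orbitMeans : Set (WeakDual ℝ Cub) :=
  {φ | ∃ ω ∈ growth, ∃ U : Ultrafilter ℝ≥0,
    (∀ A ∈ U, ¬ Bornology.IsBounded A) ∧ φ = orbitMean ω U}

end InvMeans

end

open Filter Topology

namespace InvMeans

/-! The set of invariant means is convex and weak* closed, and it contains `orbitMeans`, since
translating `f` by `s` changes its averages only by `O(s / x)`. Conversely, weak* continuous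
functionals are evaluations, so by Hahn-Banach it suffices to find, for each invariant mean `φ` and
each `f`, some `ψ ∈ orbitMeans` with `φ f ≤ ψ f`. Invariance and positivity yield arbitrarily
distant long blocks on which `f` averages almost `φ f` (`exists_lt_blockIntegral`). Starting where a
primitive is minimal makes all averages up to a given length large
(`exists_forall_le_blockIntegral`). By compactness such starting points accumulate at some `ω ∈
growth` whose orbit averages are all at least `φ f`; any admissible ultrafilter then gives `ψ`. -/

noncomputable instance : NormedAlgebra ℝ Cub := Subalgebra.toNormedAlgebra Cub

noncomputable instance : NormedSpace ℝ Cub := NormedAlgebra.toNormedSpace Cub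

instance : CompactSpace Omega := by
  have h := @WeakDual.CharacterSpace.instCompactSpaceElemCharacterSpaceOfProperSpace ℝ Cub _ _ _ _ _
  exact h

/-! ### Block integrals and orbit averages -/

/-- The integral `∫₀ᴸ T_t f dt`, taken in the Banach space `C_ub(ℝ₊)`. -/
noncomputable def blockIntegral (f : Cub) (L : ℝ) : Cub :=
  ∫ t in (0 : ℝ)..L, translate t.toNNReal f

theorem continuous_translate_toNNReal (f : Cub) :
    Continuous fun t : ℝ => translate t.toNNReal f :=
  (continuous_translate f).comp continuous_real_toNNReal

/-- Integrating in the Banach space lets means and characters alike pass under the integral. -/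
theorem map_blockIntegral (ψ : Cub →L[ℝ] ℝ) (f : Cub) (L : ℝ) :
    ψ (blockIntegral f L) = ∫ t in (0 : ℝ)..L, ψ (translate t.toNNReal f) :=
  (ContinuousLinearMap.intervalIntegral_comp_comm (𝕜 := ℝ) (E := Cub) (F := ℝ)
    (μ := MeasureTheory.volume) (f := fun t => translate t.toNNReal f) ψ
    ((continuous_translate_toNNReal f).intervalIntegrable 0 L)).symm

theorem extend_blockIntegral (ω : Omega) (f : Cub) (L : ℝ) :
    extend (blockIntegral f L) ω = ∫ t in (0 : ℝ)..L, extend f (flow t.toNNReal ω) :=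
  map_blockIntegral (WeakDual.CharacterSpace.toCLM ω) f L

theorem blockIntegral_apply (f : Cub) (L : ℝ) (x : ℝ≥0) :
    (blockIntegral f L).1 x = ∫ t in (0 : ℝ)..L, f.1 (x + t.toNNReal) :=
  extend_blockIntegral (point x) f L

/-- Characters are contractive, and `f ≥ 0` gives `‖‖f‖ - f‖ ≤ ‖f‖`, so `‖f‖ - ω f ≤ ‖f‖`. -/
theorem extend_nonneg {f : Cub} (hf : ∀ x, 0 ≤ f.1 x) (ω : Omega) : 0 ≤ extend f ω := by
  have h1 : ‖algebraMap ℝ Cub ‖f‖ - f‖ ≤ ‖f‖ := by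
    refine (BoundedContinuousFunction.norm_le
      (f := (algebraMap ℝ Cub ‖f‖ - f).1) (norm_nonneg f)).2 fun x => ?_
    have h2 : f.1 x ≤ ‖f‖ := (le_abs_self _).trans (f.1.norm_coe_le_norm x)
    have h3 : (algebraMap ℝ Cub ‖f‖ - f).1 x = ‖f‖ - f.1 x := rfl
    rw [h3, Real.norm_eq_abs, abs_le]
    have := hf x
    constructor <;> linarith
  have h2 := (le_abs_self _).trans ((abs_extend_le _ ω).trans h1)
  have h3 : extend (algebraMap ℝ Cub ‖f‖ - f) ω = ‖f‖ - extend f ω := by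
    refine (map_sub ω _ f).trans (congrArg (· - ω f) ?_)
    exact AlgHomClass.commutes ω ‖f‖
  rw [h3] at h2
  linarith

theorem orbitAverage_nonneg {f : Cub} (hf : ∀ x, 0 ≤ f.1 x) (ω : Omega) (x : ℝ≥0) :
    0 ≤ orbitAverage ω f x :=
  mul_nonneg (by positivity)
    (intervalIntegral.integral_nonneg x.coe_nonneg fun _ _ => extend_nonneg hf _)

theorem orbitAverage_one (ω : Omega) {x : ℝ≥0} (hx : x ≠ 0) : orbitAverage ω 1 x = 1 := by
  have h : ∀ t : ℝ, extend 1 (flow t.toNNReal ω) = 1 := fun t => map_one (flow t.toNNReal ω)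
  have hx' : (x : ℝ) ≠ 0 := by exact_mod_cast hx
  simp [orbitAverage, h, hx']

/-- Moving `f` along the orbit changes its average up to time `x` by at most `2 s ‖f‖ / x`. -/
theorem abs_orbitAverage_translate_sub_le (ω : Omega) (f : Cub) (s x : ℝ≥0) :
    |orbitAverage ω (translate s f) x - orbitAverage ω f x| ≤ 2 * s * ‖f‖ * (x : ℝ)⁻¹ := by
  set h : ℝ → ℝ := fun t => extend f (flow t.toNNReal ω) with hdef
  have hc : Continuous h := continuous_orbit ω f
  have hi : ∀ a b, IntervalIntegrable h MeasureTheory.volume a b :=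
    fun a b => hc.intervalIntegrable a b
  have hs : ∫ t in (0 : ℝ)..x, extend (translate s f) (flow t.toNNReal ω) =
      ∫ t in (0 : ℝ) + s..x + s, h t := by
    rw [← intervalIntegral.integral_comp_add_right]
    refine intervalIntegral.integral_congr fun t ht => ?_
    rw [Set.uIcc_of_le x.coe_nonneg] at ht
    have e : (t + s).toNNReal = t.toNNReal + s := by
      rw [Real.toNNReal_add ht.1 s.coe_nonneg, Real.toNNReal_coe]
    simp only [hdef, e]
    change ω _ = ω _
    congr 1
    apply Subtype.ext
    ext y
    change f.1 (y + t.toNNReal + s) = f.1 (y + (t.toNNReal + s))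
    rw [add_assoc]
  have hb : ∀ a b : ℝ, |∫ t in a..b, h t| ≤ ‖f‖ * |b - a| := fun a b =>
    intervalIntegral.norm_integral_le_of_norm_le_const (f := h) fun t _ =>
      abs_extend_le f (flow t.toNNReal ω)
  -- The common part cancels, leaving two end pieces of length `s`.
  have e1 : orbitAverage ω (translate s f) x - orbitAverage ω f x =
      (x : ℝ)⁻¹ * ((∫ t in (x : ℝ)..x + s, h t) - ∫ t in (0 : ℝ)..s, h t) := by
    rw [orbitAverage, orbitAverage, hs, zero_add, one_div, ← mul_sub]
    congr 1
    have h1 := intervalIntegral.integral_add_adjacent_intervals (hi 0 x) (hi x (x + s))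
    have h2 := intervalIntegral.integral_add_adjacent_intervals (hi 0 s) (hi s (x + s))
    change _ - (∫ t in (0 : ℝ)..x, h t) = _
    linarith
  have b1 := hb x (x + s)
  have b2 := hb 0 s
  rw [add_sub_cancel_left, abs_of_nonneg s.coe_nonneg] at b1
  rw [sub_zero, abs_of_nonneg s.coe_nonneg] at b2
  rw [e1, abs_mul, abs_of_nonneg (by positivity : (0 : ℝ) ≤ (x : ℝ)⁻¹), mul_comm]
  refine mul_le_mul_of_nonneg_right ?_ (by positivity)
  refine (abs_sub _ _).trans ?_
  linarith

/-! ### Orbit means are invariant means -/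

theorem le_atTop_of_not_isBounded {U : Ultrafilter ℝ≥0}
    (hU : ∀ A ∈ U, ¬ Bornology.IsBounded A) : (U : Filter ℝ≥0) ≤ atTop := by
  refine le_iInf fun a => le_principal_iff.2 ?_
  by_contra h
  refine hU _ (Ultrafilter.compl_mem_iff_notMem.2 h) ?_
  exact (Metric.isBounded_Icc 0 a).subset fun y hy => ⟨zero_le, (not_le.1 (Set.mem_Ici.not.1 hy)).le⟩

theorem exists_ultrafilter_not_isBounded :
    ∃ U : Ultrafilter ℝ≥0, ∀ A ∈ U, ¬ Bornology.IsBounded A := by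
  refine ⟨Ultrafilter.of atTop, fun A hA hb => ?_⟩
  obtain ⟨c, hc⟩ := hb.bddAbove
  have h : Set.Ioi c ∈ Ultrafilter.of (atTop : Filter ℝ≥0) :=
    Ultrafilter.of_le _ (Ioi_mem_atTop c)
  obtain ⟨y, hy, hy'⟩ := (Ultrafilter.of (atTop : Filter ℝ≥0)).nonempty_of_mem (inter_mem hA h)
  exact (not_le.2 hy') (hc hy)

theorem tendsto_orbitMean (ω : Omega) (U : Ultrafilter ℝ≥0) (f : Cub) :
    Tendsto (orbitAverage ω f) U (𝓝 (orbitMean ω U f)) :=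
  tendsto_orbitAverage ω U f

theorem orbitMeans_subset_invariantMeans : orbitMeans ⊆ invariantMeans := by
  rintro _ ⟨ω, -, U, hU, rfl⟩
  have hle := le_atTop_of_not_isBounded hU
  refine ⟨fun f hf => ?_, ?_, fun s f => ?_⟩
  · exact ge_of_tendsto (tendsto_orbitMean ω U f)
      (Eventually.of_forall fun x => orbitAverage_nonneg hf ω x)
  · refine tendsto_nhds_unique (tendsto_orbitMean ω U 1) (tendsto_const_nhds.congr' ?_)
    filter_upwards [hle (Ioi_mem_atTop 0)] with x hx
    exact (orbitAverage_one ω (ne_of_gt hx)).symm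
  · have h0 : Tendsto (fun x : ℝ≥0 => 2 * s * ‖f‖ * (x : ℝ)⁻¹) U (𝓝 0) := by
      have h := (tendsto_inv_atTop_zero (𝕜 := ℝ)).comp
        ((NNReal.tendsto_coe_atTop.2 tendsto_id).mono_left hle)
      simpa using h.const_mul (2 * s * ‖f‖)
    have h1 := squeeze_zero_norm (f := fun x => orbitAverage ω (translate s f) x - orbitAverage ω f x)
      (abs_orbitAverage_translate_sub_le ω f s) h0
    exact sub_eq_zero.1 (tendsto_nhds_unique
      ((tendsto_orbitMean ω U (translate s f)).sub (tendsto_orbitMean ω U f)) h1)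

theorem convex_invariantMeans : Convex ℝ invariantMeans := by
  rintro φ ⟨hp, h1, hi⟩ ψ ⟨hp', h1', hi'⟩ a b ha hb hab
  have e : ∀ f, (a • φ + b • ψ) f = a * φ f + b * ψ f := fun _ => rfl
  refine ⟨fun f hf => ?_, ?_, fun s f => ?_⟩
  · rw [e]
    exact add_nonneg (mul_nonneg ha (hp f hf)) (mul_nonneg hb (hp' f hf))
  · rw [e, h1, h1', mul_one, mul_one, hab]
  · rw [e, e, hi, hi']

theorem isClosed_invariantMeans : IsClosed invariantMeans := by
  have hc := fun f : Cub => WeakDual.eval_continuous (𝕜 := ℝ) f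
  simp only [invariantMeans, Set.ofPred_and, Set.ofPred_forall]
  refine IsClosed.inter ?_ (IsClosed.inter ?_ ?_)
  · exact isClosed_iInter fun f => isClosed_iInter fun _ => isClosed_le continuous_const (hc f)
  · exact isClosed_eq (hc 1) continuous_const
  · exact isClosed_iInter fun s => isClosed_iInter fun f => isClosed_eq (hc _) (hc f)

/-! ### Stretches with uniformly large averages -/

/-- If the integral of `g` over `[0, L]` is large, then all the integrals of `g` over short
intervals starting at a suitable point of `[0, L]` are nonnegative. -/
theorem exists_forall_integral_nonneg {g : ℝ → ℝ} (hg : Continuous g) {C L N : ℝ} (hC : 0 < C)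
    (hb : ∀ t, |g t| ≤ C) (hL : 0 ≤ L) (h : C * N ≤ ∫ t in (0 : ℝ)..L, g t) :
    ∃ y ∈ Set.Icc 0 L, ∀ T ∈ Set.Icc 0 N, 0 ≤ ∫ t in y..y + T, g t := by
  have hi : ∀ a b, IntervalIntegrable g MeasureTheory.volume a b :=
    fun a b => hg.intervalIntegrable a b
  -- Take `y` minimizing the primitive on `[0, L]`. Its value at `y` is at most `0`, so the integral
  -- over `[y, L]` is at least `C * N`, which forces `L - y ≥ N`.
  obtain ⟨y, hy, hmin⟩ := (isCompact_Icc (a := (0 : ℝ)) (b := L)).exists_isMinOn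
    (Set.nonempty_Icc.2 hL) (intervalIntegral.continuous_primitive hi 0).continuousOn
  rw [isMinOn_iff] at hmin
  have h0 := hmin 0 ⟨le_rfl, hL⟩
  rw [intervalIntegral.integral_same] at h0
  have hadd := intervalIntegral.integral_add_adjacent_intervals (hi 0 y) (hi y L)
  have hle : (∫ t in y..L, g t) ≤ C * |L - y| := (le_abs_self _).trans
    (intervalIntegral.norm_integral_le_of_norm_le_const (f := g) fun t _ => hb t)
  rw [abs_of_nonneg (sub_nonneg.2 hy.2)] at hle
  have hN : N ≤ L - y := le_of_mul_le_mul_left (by linarith) hC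
  refine ⟨y, hy, fun T hT => ?_⟩
  have h1 := hmin (y + T) ⟨add_nonneg hy.1 hT.1, by linarith [hT.2]⟩
  have h2 := intervalIntegral.integral_add_adjacent_intervals (hi 0 y) (hi y (y + T))
  linarith

/-- Otherwise the block integral translated by `n` is at most `(φ f - δ) * L` everywhere, while `φ`
gives it the value `L * φ f`. -/
theorem exists_lt_blockIntegral {φ : WeakDual ℝ Cub} (hφ : φ ∈ invariantMeans) (f : Cub)
    {δ L : ℝ} (hδ : 0 < δ) (hL : 0 < L) (n : ℝ≥0) :
    ∃ x, n ≤ x ∧ (φ f - δ) * L < (blockIntegral f L).1 x := by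
  by_contra! hcon
  obtain ⟨hp, h1, hi⟩ := hφ
  have hpos := hp (((φ f - δ) * L) • (1 : Cub) - translate n (blockIntegral f L)) fun x => by
    change 0 ≤ (φ f - δ) * L * 1 - (blockIntegral f L).1 (x + n)
    linarith [hcon (x + n) le_add_self]
  have hint : φ (blockIntegral f L) = L * φ f := by
    refine (map_blockIntegral (WeakDual.toStrongDual φ) f L).trans ?_
    simp only [WeakDual.toStrongDual_apply, hi, intervalIntegral.integral_const, sub_zero,
      smul_eq_mul]
  have hsub : φ (((φ f - δ) * L) • (1 : Cub) - translate n (blockIntegral f L)) =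
      (φ f - δ) * L * φ 1 - φ (translate n (blockIntegral f L)) :=
    (map_sub φ _ _).trans (congrArg (· - _) (map_smul φ _ _))
  rw [hsub, h1, hi, hint] at hpos
  nlinarith [mul_pos hδ hL]

theorem exists_forall_le_blockIntegral {φ : WeakDual ℝ Cub} (hφ : φ ∈ invariantMeans) (f : Cub)
    {ε N : ℝ} (hε : 0 < ε) (hN : 0 < N) (n : ℝ≥0) :
    ∃ x, n ≤ x ∧ ∀ T ∈ Set.Icc 0 N, (φ f - ε) * T ≤ (blockIntegral f T).1 x := by
  set C : ℝ := ‖f‖ + |φ f - ε| + 1 with hCdef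
  have hC : 0 < C := by positivity
  -- Chosen so that the surplus `ε / 2 * L` of the block over `(φ f - ε) * L` equals `C * N`.
  set L : ℝ := 2 * C * N / ε with hLdef
  have hL : 0 < L := by positivity
  obtain ⟨x, hx, hlt⟩ := exists_lt_blockIntegral hφ f (half_pos hε) hL n
  have hc : Continuous fun t : ℝ => f.1 (x + t.toNNReal) := continuous_orbit (point x) f
  obtain ⟨y, hy, hpos⟩ := exists_forall_integral_nonneg
    (g := fun t => f.1 (x + t.toNNReal) - (φ f - ε)) (N := N) (hc.sub continuous_const) hC
    (fun t => by
      refine (abs_sub _ _).trans ?_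
      have h : |f.1 (x + t.toNNReal)| ≤ ‖f‖ := f.1.norm_coe_le_norm _
      linarith) hL.le (by
      rw [intervalIntegral.integral_sub (hc.intervalIntegrable _ _)
        (continuous_const.intervalIntegrable _ _), ← blockIntegral_apply,
        intervalIntegral.integral_const, sub_zero, smul_eq_mul]
      have e : ε / 2 * L = C * N := by
        rw [hLdef]
        field_simp
      nlinarith)
  refine ⟨x + y.toNNReal, hx.trans le_self_add, fun T hT => ?_⟩
  have h := hpos T hT
  rw [intervalIntegral.integral_sub (hc.intervalIntegrable _ _)
    (continuous_const.intervalIntegrable _ _), intervalIntegral.integral_const,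
    add_sub_cancel_left, smul_eq_mul] at h
  have e : (blockIntegral f T).1 (x + y.toNNReal) =
      ∫ t in y..y + T, f.1 (x + t.toNNReal) := by
    have hshift := intervalIntegral.integral_comp_add_left
      (fun t : ℝ => f.1 (x + t.toNNReal)) (a := 0) (b := T) y
    rw [add_zero] at hshift
    rw [blockIntegral_apply, ← hshift]
    refine intervalIntegral.integral_congr fun t ht => ?_
    rw [Set.uIcc_of_le hT.1] at ht
    simp only [Real.toNNReal_add hy.1 ht.1, add_assoc]
  rw [e]
  linarith

/-! ### Passage to the growth -/

/-- The function `x ↦ min (dist x p) 1`, which vanishes only at `p`. -/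
noncomputable def truncatedDist (p : ℝ≥0) : Cub :=
  ⟨BoundedContinuousFunction.ofNormedAddCommGroup (fun x => min (dist x p) 1)
      (by fun_prop) 1 fun x => by
        rw [Real.norm_eq_abs, abs_of_nonneg (le_min dist_nonneg zero_le_one)]
        exact min_le_right _ _,
    ((LipschitzWith.dist_left p).min_const 1).uniformContinuous⟩

theorem truncatedDist_apply (p x : ℝ≥0) : (truncatedDist p).1 x = min (dist x p) 1 := rfl

/-- If `ω` were the point `p`, the extension of `truncatedDist p` would vanish there, yet it tends
to `1` along `y`. -/
theorem mem_growth_of_tendsto {V : Filter ℕ} [V.NeBot] {y : ℕ → ℝ≥0} {ω : Omega}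
    (hy : Tendsto y V atTop) (hω : Tendsto (fun n => point (y n)) V (𝓝 ω)) : ω ∈ growth := by
  rintro ⟨p, rfl⟩
  have h := ((extend (truncatedDist p)).continuous.tendsto (point p)).comp hω
  have h1 : Tendsto ((extend (truncatedDist p)) ∘ fun n => point (y n)) V (𝓝 1) := by
    refine tendsto_const_nhds.congr' ?_
    filter_upwards [hy.eventually (eventually_ge_atTop (p + 1))] with n hn
    have hn' : (p : ℝ) + 1 ≤ y n := by exact_mod_cast hn
    rw [Function.comp_apply, extend_point, truncatedDist_apply, NNReal.dist_eq, min_eq_right]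
    exact le_trans (by linarith) (le_abs_self _)
  have h2 := tendsto_nhds_unique h h1
  rw [extend_point, truncatedDist_apply] at h2
  simp at h2

/-- For every invariant mean `φ` and every `f` there is an orbit in the growth all of whose
averages of `f` are at least `φ f`. -/
theorem exists_mem_growth_forall_le_orbitAverage {φ : WeakDual ℝ Cub} (hφ : φ ∈ invariantMeans)
    (f : Cub) : ∃ ω ∈ growth, ∀ x : ℝ≥0, x ≠ 0 → φ f ≤ orbitAverage ω f x := by
  choose y hy hle using fun n : ℕ => exists_forall_le_blockIntegral hφ f
    (ε := 1 / ((n : ℝ) + 1)) (N := (n : ℝ) + 1) (by positivity) (by positivity) n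
  let V : Ultrafilter ℕ := Ultrafilter.of atTop
  have hV : (V : Filter ℕ) ≤ atTop := Ultrafilter.of_le _
  have hyV : Tendsto y V atTop :=
    (tendsto_atTop_mono hy tendsto_natCast_atTop_atTop).mono_left hV
  obtain ⟨ω, -, hω⟩ := (isCompact_univ (X := Omega)).ultrafilter_le_nhds
    (V.map fun n => point (y n)) (by simp)
  have hω : Tendsto (fun n => point (y n)) V (𝓝 ω) := hω
  refine ⟨ω, mem_growth_of_tendsto hyV hω, fun x hx => ?_⟩
  have hx' : (0 : ℝ) < x := by positivity
  have hlim := ((extend (blockIntegral f x)).continuous.tendsto ω).comp hω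
  have hlow : Tendsto (fun n : ℕ => (φ f - 1 / ((n : ℝ) + 1)) * x) V (𝓝 ((φ f - 0) * x)) :=
    ((tendsto_const_nhds.sub tendsto_one_div_add_atTop_nhds_zero_nat).mul_const _).mono_left hV
  have hfin := le_of_tendsto_of_tendsto hlow hlim (by
    -- For fixed `x`, the bound at `y n` covers length `x` once `n ≥ x`.
    filter_upwards [hV (eventually_ge_atTop ⌈(x : ℝ)⌉₊)] with n hn
    exact hle n x ⟨hx'.le, (Nat.ceil_le.1 hn).trans (by linarith)⟩)
  rw [sub_zero, extend_blockIntegral] at hfin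
  rw [orbitAverage, one_div, inv_mul_eq_div, le_div_iff₀ hx']
  exact hfin

theorem exists_mem_orbitMeans_le {φ : WeakDual ℝ Cub} (hφ : φ ∈ invariantMeans) (f : Cub) :
    ∃ ψ ∈ orbitMeans, φ f ≤ ψ f := by
  obtain ⟨ω, hω, hle⟩ := exists_mem_growth_forall_le_orbitAverage hφ f
  obtain ⟨U, hU⟩ := exists_ultrafilter_not_isBounded
  refine ⟨orbitMean ω U, ⟨ω, hω, U, hU, rfl⟩, ge_of_tendsto (tendsto_orbitMean ω U f) ?_⟩
  filter_upwards [le_atTop_of_not_isBounded hU (Ioi_mem_atTop 0)] with x hx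
  exact hle x (ne_of_gt hx)

end InvMeans

/-! ### Separation and conclusion -/

/-- A functional that is dominated, at each point of the predual, by an element of `s` lies in the
weak* closed convex hull of `s`. -/
theorem WeakDual.mem_closure_convexHull {E : Type*} [AddCommGroup E] [Module ℝ E]
    [TopologicalSpace E] {s : Set (WeakDual ℝ E)} {φ : WeakDual ℝ E}
    (h : ∀ f, ∃ ψ ∈ s, φ f ≤ ψ f) : φ ∈ closure (convexHull ℝ s) := by
  have : LocallyConvexSpace ℝ (WeakDual ℝ E) :=
    inferInstanceAs (LocallyConvexSpace ℝ (WeakBilin (topDualPairing ℝ E)))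
  by_contra hφ
  obtain ⟨F, u, hF, hu⟩ :=
    geometric_hahn_banach_closed_point (convex_convexHull ℝ s).closure isClosed_closure hφ
  -- The separating functional is evaluation at some `f`.
  obtain ⟨f, rfl⟩ := LinearMap.dualEmbedding_surjective (topDualPairing ℝ E) F
  obtain ⟨ψ, hψ, hle⟩ := h f
  exact absurd (hF ψ (subset_closure (subset_convexHull ℝ s hψ))) (not_lt.2 (hu.le.trans hle))

theorem theorem2p2 :
    InvMeans.invariantMeans = closure (convexHull ℝ InvMeans.orbitMeans) := by
  refine Set.Subset.antisymm (fun φ hφ => ?_) (closure_minimal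
    (convexHull_min InvMeans.orbitMeans_subset_invariantMeans InvMeans.convex_invariantMeans)
    InvMeans.isClosed_invariantMeans)
  have h := @WeakDual.mem_closure_convexHull InvMeans.Cub _ _ _ InvMeans.orbitMeans φ
  exact h (InvMeans.exists_mem_orbitMeans_le hφ)
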